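/- Consider $N\ge 1$ spins $1/2$ on a ring (sites taken modulo $N$) with the transverse-field Ising Hamiltonian $$H(f)=-\sum_{j}\sigma^x_j\sigma^x_{j+1}+\sum_j f_j\,\sigma^z_j ,\qquad f=(f_j)\in\mathbb R^N .$$ Let $|\psi_0\rangle=(|{\rightarrow}\cdots{\rightarrow}\rangle+|{\leftarrow}\cdots{\leftarrow}\rangle)/\sqrt2$, where $|{\rightarrow}\rangle,|{\leftarrow}\rangle$ are the eigenvectors of $\sigma^x$ with eigenvalues $+1,-1$, and for an operator $O$ write $\langle O\rangle_{f,t}=\langle\psi_0|e^{itH(f)}\,O\,e^{-itH(f)}|\psi_0\rangle$. Fix a homogeneous post-quench field $h>1$, integers $L,d,P\ge 0$ and reals $C,T$. A weak long-wavelength disorder is a field $$\delta_j=\sum_{p=0}^{P}\Big(u_p\cos\tfrac{2\pi p j}{N}+v_p\sin\tfrac{2\pi p j}{N}\Big),\qquad |u_p|,|v_p|\le C N^{-3},$$ that is, its only Fourier components have wave number $O(N^{-1})$ and are of order $O(N^{-3})$. Write $\Delta\langle O\rangle_t=\langle O\rangle_{h+\delta,t}-\langle O\rangle_{h,t}$.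 Then: 1. If $L$ is even, there is a constant $K$ depending only on $h,L,d,P,C,T$ such that for all $N\ge1$, all such $\delta$, all sites $i_1,\dots,i_L$ whose mutual distances on the ring are at most $d$, and all times $|t|\le T N^2$ (in particular, for $N$ large enough, at every fixed time $t$ if $T>0$), $$\big|\Delta\langle\sigma^x_{i_1}\sigma^x_{i_2}\cdots\sigma^x_{i_L}\rangle_t\big|\le \frac KN .$$ 2. If $L$ is odd, then $\langle\sigma^x_{i_1}\cdots\sigma^x_{i_L}\rangle_{f,t}=0$ for all $N$, all fields $f$, all sites and all $t\in\mathbb R$. 3. For every $L$ there is a constant $K$ depending only on $h,L,P,C,T$ such that for all $N\ge1$, all such $\delta$, all sites $i_1,\dots,i_L$ (at arbitrary distances) and all $|t|\le TN^2$, $$\big|\Delta\langle\sigma^z_{i_1}\sigma^z_{i_2}\cdots\sigma^z_{i_L}\rangle_t\big|\le \frac KN .$$ -/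

import Mathlib

open scoped Matrix

noncomputable section

namespace IsingQuench

/-- Basis configurations of a chain of `N` spins-1/2; the value `0` is the `σᶻ = +1` state. -/
abbrev Config (N : ℕ) : Type := Fin N → Fin 2

/-- Operators on the state space `(ℂ²)^{⊗ N}`, as matrices in the `σᶻ` product basis. -/
abbrev Op (N : ℕ) : Type := Matrix (Config N) (Config N) ℂ

/-- The Pauli matrix `σˣ`. -/
def pauliX : Matrix (Fin 2) (Fin 2) ℂ := !![0, 1; 1, 0]

/-- The Pauli matrix `σᶻ`. -/
def pauliZ : Matrix (Fin 2) (Fin 2) ℂ := !![1, 0; 0, -1]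

/-- The one-site operator `1 ⊗ ⋯ ⊗ A ⊗ ⋯ ⊗ 1` with `A` acting at the site `j`. -/
def siteOp {N : ℕ} (A : Matrix (Fin 2) (Fin 2) ℂ) (j : Fin N) : Op N :=
  Matrix.of fun s s' => if ∀ k, k ≠ j → s k = s' k then A (s j) (s' j) else 0

/-- `σˣ` at the site `j`. -/
def sigmaX {N : ℕ} (j : Fin N) : Op N := siteOp pauliX j

/-- `σᶻ` at the site `j`. -/
def sigmaZ {N : ℕ} (j : Fin N) : Op N := siteOp pauliZ j

/-- The transverse-field Ising Hamiltonian `-∑ σˣ_j σˣ_{j+1} + ∑ f_j σᶻ_j` (coupling `J = 1`) with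
periodic boundary conditions: addition in `Fin N` is modulo `N`. -/
def hamiltonian {N : ℕ} [NeZero N] (f : Fin N → ℝ) : Op N :=
  -(∑ j : Fin N, sigmaX j * sigmaX (j + 1)) + ∑ j : Fin N, (f j : ℂ) • sigmaZ j

/-- All spins in the `σˣ = +1` state. -/
def rightState (N : ℕ) : Config N → ℂ :=
  fun _ => ∏ _j : Fin N, ((1 / Real.sqrt 2 : ℝ) : ℂ)

/-- All spins in the `σˣ = -1` state. -/
def leftState (N : ℕ) : Config N → ℂ :=
  fun s => ∏ j : Fin N, if s j = 0 then ((1 / Real.sqrt 2 : ℝ) : ℂ) else -((1 / Real.sqrt 2 : ℝ) : ℂ)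

/-- The initial state `(|→⟩ + |←⟩) / √2`, the ground state at zero field with an even number of
fermions. -/
def catState (N : ℕ) : Config N → ℂ :=
  ((1 / Real.sqrt 2 : ℝ) : ℂ) • (rightState N + leftState N)

/-- The state at time `t` after the quench to the fields `f`: `exp(-i t H(f))` applied to the
initial state. -/
def evolvedState {N : ℕ} [NeZero N] (f : Fin N → ℝ) (t : ℝ) : Config N → ℂ :=
  NormedSpace.exp ((-(Complex.I * (t : ℂ))) • hamiltonian f) *ᵥ catState N

/-- The average `⟨ψ(t)| O |ψ(t)⟩` after the quench to the fields `f`. -/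
def average {N : ℕ} [NeZero N] (f : Fin N → ℝ) (t : ℝ) (O : Op N) : ℂ :=
  star (evolvedState f t) ⬝ᵥ (O *ᵥ evolvedState f t)

/-- The correlator `⟨σˣ_{i₁} ⋯ σˣ_{i_L}⟩` at time `t`. -/
def corrX {N L : ℕ} [NeZero N] (f : Fin N → ℝ) (t : ℝ) (i : Fin L → Fin N) : ℂ :=
  average f t (List.ofFn fun a => sigmaX (i a)).prod

/-- The correlator `⟨σᶻ_{i₁} ⋯ σᶻ_{i_L}⟩` at time `t`. -/
def corrZ {N L : ℕ} [NeZero N] (f : Fin N → ℝ) (t : ℝ) (i : Fin L → Fin N) : ℂ :=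
  average f t (List.ofFn fun a => sigmaZ (i a)).prod

/-- The distance of two sites on the periodic chain (subtraction in `Fin N` is modulo `N`). -/
def siteDist {N : ℕ} (i j : Fin N) : ℕ := min (i - j).val (j - i).val

/-- The field with the Fourier components `u p` and `v p` at the wave numbers `q = 2πp/N`,
`0 ≤ p ≤ P`, and no others: `j ↦ ∑ p, (u p * cos (q j) + v p * sin (q j))`. -/
def longWaveField (N P : ℕ) (u v : Fin (P + 1) → ℝ) : Fin N → ℝ := fun j =>
  ∑ p : Fin (P + 1),
    (u p * Real.cos (2 * Real.pi * ((p : ℕ) : ℝ) / (N : ℝ) * ((j : ℕ) : ℝ)) +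
      v p * Real.sin (2 * Real.pi * ((p : ℕ) : ℝ) / (N : ℝ) * ((j : ℕ) : ℝ)))

end IsingQuench

end

/-! The Hamiltonian and the initial state are invariant under the parity `∏ σᶻ`, and the state is
even. An odd product of `σˣ` is odd under parity, so its average vanishes. On the even sector the
Jordan-Wigner transformation makes `i H` a quadratic form in `2N` Majorana operators, with
antiperiodic closure. Commutation with such a form preserves their real span
(`preservesSpan_evenGen`), where the operator norm is Euclidean (`norm_sum_smul_sq`). An on-site
perturbation `δ` therefore acts there with norm at most `2 sup |δ|`, with no factor `N`
(`norm_comm_sum_le`), and Duhamel's formula bounds the change of an evolved Majorana operator by `2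
|t| sup |δ|`.

Errors add up over products (`HeisClose.mul`). Each `σᶻ` and, on the even sector, each bond `σˣσˣ`
is a product of two Majoranas up to a phase; a pair of `σˣ` at distance at most `d` is a product of
at most `d` bonds. The number of factors is thus bounded independently of `N`, and `sup |δ| =
O(N⁻³)` with `|t| = O(N²)` leaves `O(1/N)`. -/

namespace IsingQuench

/-! ### Heisenberg evolution and Duhamel's estimate in a C*-algebra. -/

section Dynamics

variable {A : Type*} [CStarAlgebra A]

/-- The Heisenberg evolution `exp(t G) c exp(-t G)` generated by `G`. -/
noncomputable def heis (G : A) (t : ℝ) (c : A) : A :=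
  NormedSpace.exp (t • G) * c * NormedSpace.exp (t • (-G))

/-- The argument is allowed to move so that `w` can itself be an evolved element: with `-G` in place
of `G`, one evolution is differentiated after being undone by another. -/
theorem hasDerivAt_conj_exp (G : A) {w : ℝ → A} {w' : A} {s : ℝ}
    (hw : HasDerivAt w w' s) :
    HasDerivAt (fun s => heis G s (w s)) (heis G s (G * w s - w s * G + w')) s := by
  have h1 := hasDerivAt_exp_smul_const (𝕂 := ℝ) G s
  have h2 := hasDerivAt_exp_smul_const' (𝕂 := ℝ) (-G) s
  convert! (h1.mul hw).mul h2 using 1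
  simp only [heis, Pi.mul_apply]
  noncomm_ring

theorem exp_mul_exp_neg (G : A) (t : ℝ) :
    NormedSpace.exp (t • G) * NormedSpace.exp (t • (-G)) = 1 := by
  let := NormedAlgebra.restrictScalars ℚ ℂ A
  rw [← NormedSpace.exp_add_of_commute]
  · simp
  · exact ((Commute.refl G).neg_right.smul_right t).smul_left t

theorem exp_neg_mul_exp (G : A) (t : ℝ) :
    NormedSpace.exp (t • (-G)) * NormedSpace.exp (t • G) = 1 := by
  simpa using exp_mul_exp_neg (-G) t

theorem heis_mul (G : A) (t : ℝ) (b c : A) : heis G t (b * c) = heis G t b * heis G t c := by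
  simp only [heis]
  calc _ = NormedSpace.exp (t • G) * b * 1 * c * NormedSpace.exp (t • (-G)) := by noncomm_ring
    _ = _ := by rw [← exp_neg_mul_exp G t]; noncomm_ring

theorem heis_zero (G : A) (c : A) : heis G 0 c = c := by simp [heis]

theorem heis_sub (G : A) (t : ℝ) (b c : A) : heis G t (b - c) = heis G t b - heis G t c := by
  simp [heis, mul_sub, sub_mul]

theorem heis_smul (G : A) (t : ℝ) (z : ℂ) (c : A) : heis G t (z • c) = z • heis G t c := by
  simp [heis]

theorem heis_one (G : A) (t : ℝ) : heis G t 1 = 1 := by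
  rw [heis, mul_one, exp_mul_exp_neg]

theorem heis_neg_heis (G : A) (t : ℝ) (c : A) : heis G t (heis (-G) t c) = c := by
  simp only [heis, neg_neg]
  calc _ = (NormedSpace.exp (t • G) * NormedSpace.exp (t • (-G))) * c *
        (NormedSpace.exp (t • G) * NormedSpace.exp (t • (-G))) := by noncomm_ring
    _ = c := by rw [exp_mul_exp_neg, one_mul, mul_one]

theorem star_exp_skew {G : A} (hG : star G = -G) (t : ℝ) :
    star (NormedSpace.exp (t • G)) = NormedSpace.exp (t • (-G)) := by
  rw [NormedSpace.star_exp, star_smul, hG]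
  simp

theorem norm_heis {G : A} (hG : star G = -G) (t : ℝ) (c : A) : ‖heis G t c‖ = ‖c‖ := by
  have hu : NormedSpace.exp (t • G) ∈ unitary A := by
    rw [Unitary.mem_iff, star_exp_skew hG]
    exact ⟨exp_neg_mul_exp G t, exp_mul_exp_neg G t⟩
  have hu' : NormedSpace.exp (t • (-G)) ∈ unitary A := by
    rw [← star_exp_skew hG]; exact Unitary.star_mem hu
  rw [heis, CStarRing.norm_mul_mem_unitary _ hu', CStarRing.norm_mem_unitary_mul _ hu]

/-- A finite-dimensional subspace invariant under the commutator with `G` is invariant under the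
evolution generated by `G`. -/
theorem heis_mem {G : A} (V : Submodule ℝ A) [FiniteDimensional ℝ V]
    (hV : ∀ w ∈ V, G * w - w * G ∈ V) (t : ℝ) {c : A} (hc : c ∈ V) : heis G t c ∈ V := by
  -- With `K = [G, ·]`, the partial sums of `exp (s K) c` lie in the closed subspace `V`, hence so
  -- does the limit.
  let K : A →L[ℝ] A := ContinuousLinearMap.mul ℝ A G - (ContinuousLinearMap.mul ℝ A).flip G
  have hK : ∀ w, K w = G * w - w * G := fun w => by simp [K]
  have hclosed : IsClosed (V : Set A) := V.closed_of_finiteDimensional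
  have hmem : ∀ s : ℝ, NormedSpace.exp (s • K) c ∈ V := by
    intro s
    have hs := NormedSpace.exp_series_hasSum_exp' (𝕂 := ℝ) (s • K)
    have hs' := hs.mapL (ContinuousLinearMap.apply ℝ A c)
    refine hclosed.mem_of_tendsto hs' (Filter.Eventually.of_forall fun F => ?_)
    refine V.sum_mem fun n _ => ?_
    have hpow : ∀ n : ℕ, ((s • K) ^ n) c ∈ V := by
      intro n
      induction n with
      | zero => simpa using hc
      | succ n ih =>
        rw [pow_succ']
        rw [mul_apply_eq_comp, smul_apply, hK]
        exact V.smul_mem _ (hV _ ih)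
    exact V.smul_mem _ (hpow n)
  -- Undoing the conjugation gives a constant curve, which identifies `heis G t c` with `exp (t K)
  -- c`.
  have hder : ∀ s : ℝ, HasDerivAt (fun s => heis (-G) s (NormedSpace.exp (s • K) c)) 0 s := by
    intro s
    have h1 := (hasDerivAt_exp_smul_const' (𝕂 := ℝ) K s)
    have h2 := (ContinuousLinearMap.apply ℝ A c).hasFDerivAt.comp_hasDerivAt s h1
    convert! hasDerivAt_conj_exp (-G) h2 using 1
    simp [hK, heis]
  have hconst := is_const_of_deriv_eq_zero (fun s => (hder s).differentiableAt)
    (fun s => (hder s).deriv) t 0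
  have h0 : NormedSpace.exp ((0 : ℝ) • K) = 1 := by
    rw [show (0 : ℝ) • K = 0 from zero_smul ℝ K, NormedSpace.exp_zero]
  have : heis G t c = NormedSpace.exp (t • K) c := by
    have h3 : heis (-G) t (NormedSpace.exp (t • K) c) = c := by
      rw [hconst, heis_zero, h0]; rfl
    rw [← heis_neg_heis G t (NormedSpace.exp (t • K) c), h3]
  rw [this]
  exact hmem t

/-- Duhamel's estimate: two evolutions differ on an invariant subspace by at most the time times the
norm of the difference of the generators' commutators on that subspace. -/
theorem norm_heis_sub_heis_le {G₁ G₂ : A} (h₁ : star G₁ = -G₁) (h₂ : star G₂ = -G₂)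
    (V : Submodule ℝ A) [FiniteDimensional ℝ V] (hV : ∀ w ∈ V, G₁ * w - w * G₁ ∈ V) {κ : ℝ}
    (hκ : ∀ w ∈ V, ‖(G₁ - G₂) * w - w * (G₁ - G₂)‖ ≤ κ * ‖w‖) (t : ℝ) {c : A} (hc : c ∈ V) :
    ‖heis G₁ t c - heis G₂ t c‖ ≤ κ * ‖c‖ * |t| := by
  have hn : star (-G₂) = -(-G₂) := by rw [star_neg, h₂]
  -- Interaction picture: only the difference of the generators survives in the derivative. It acts
  -- on `heis G₁ s c`, which stays in `V` and keeps the norm of `c`, so `hκ` applies at every `s`.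
  have hder : ∀ s : ℝ, HasDerivAt (fun s => heis (-G₂) s (heis G₁ s c))
      (heis (-G₂) s ((G₁ - G₂) * heis G₁ s c - heis G₁ s c * (G₁ - G₂))) s := by
    intro s
    have h1 := hasDerivAt_conj_exp G₁ (hasDerivAt_const s c)
    have h1' : HasDerivAt (fun s => heis G₁ s c) (G₁ * heis G₁ s c - heis G₁ s c * G₁) s := by
      convert! h1 using 1
      have e1 : Commute G₁ (NormedSpace.exp (s • G₁)) :=
        ((Commute.refl G₁).smul_right s).exp_right
      have e2 : Commute G₁ (NormedSpace.exp (s • (-G₁))) :=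
        ((Commute.refl G₁).neg_right.smul_right s).exp_right
      simp only [heis, add_zero, mul_sub, sub_mul, ← mul_assoc]
      rw [e1.eq, mul_assoc _ _ G₁, ← e2.eq, mul_assoc _ G₁, mul_assoc _ G₁, mul_assoc]
    convert! hasDerivAt_conj_exp (-G₂) h1' using 2
    noncomm_ring
  have hb := (convex_univ (𝕜 := ℝ) (E := ℝ)).norm_image_sub_le_of_norm_hasDerivWithin_le
    (C := κ * ‖c‖) (fun s _ => (hder s).hasDerivWithinAt) (fun s _ => by
      rw [norm_heis hn]
      refine (hκ _ (heis_mem V hV s hc)).trans ?_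
      rw [norm_heis h₁]) (Set.mem_univ 0) (Set.mem_univ t)
  have h3 : heis G₁ t c - heis G₂ t c = heis G₂ t (heis (-G₂) t (heis G₁ t c) - c) := by
    rw [heis_sub, heis_neg_heis]
  rw [h3, norm_heis h₂]
  simpa [heis_zero] using hb

end Dynamics

/-! ### Majorana operators and quadratic generators. -/

section Majorana

variable {A : Type*} [CStarAlgebra A]

/-- Self-adjoint elements satisfying the canonical anticommutation relations. -/
structure IsMajorana {ι : Type*} [DecidableEq ι] (γ : ι → A) : Prop where
  star_eq : ∀ μ, star (γ μ) = γ μ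
  anticomm : ∀ μ ν, γ μ * γ ν + γ ν * γ μ = if μ = ν then 2 else 0

namespace IsMajorana

variable {ι : Type*} [DecidableEq ι] {γ : ι → A}

theorem mul_self (hγ : IsMajorana γ) (μ : ι) : γ μ * γ μ = 1 := by
  have h := hγ.anticomm μ μ
  rw [if_pos rfl, ← two_smul ℂ, show (2 : A) = (2 : ℂ) • (1 : A) by
    rw [two_smul]; norm_num] at h
  exact smul_right_injective A (two_ne_zero (α := ℂ)) h

theorem mul_swap (hγ : IsMajorana γ) {μ ν : ι} (h : μ ≠ ν) : γ μ * γ ν = -(γ ν * γ μ) := by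
  rw [eq_neg_iff_add_eq_zero, hγ.anticomm, if_neg h]

theorem norm_eq_one [Nontrivial A] (hγ : IsMajorana γ) (μ : ι) : ‖γ μ‖ = 1 := by
  have h := CStarRing.norm_star_mul_self (x := γ μ)
  rw [hγ.star_eq, hγ.mul_self, norm_one] at h
  nlinarith [norm_nonneg (γ μ)]

/-- Anticommutation cancels the cross terms, so the self-adjoint combination squares to a scalar,
and the C*-identity reads off its norm. -/
theorem norm_sum_smul_sq [Nontrivial A] [Fintype ι] (hγ : IsMajorana γ) (y : ι → ℝ) :
    ‖∑ μ, y μ • γ μ‖ ^ 2 = ∑ μ, y μ ^ 2 := by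
  have hstar : star (∑ μ, y μ • γ μ) = ∑ μ, y μ • γ μ := by
    simp [star_sum, hγ.star_eq]
  have hsq : (∑ μ, y μ • γ μ) * (∑ μ, y μ • γ μ) = (∑ μ, y μ ^ 2) • (1 : A) := by
    -- Doubling the square symmetrises the double sum, so that anticommutators appear.
    have h2 : (2 : ℝ) • ((∑ μ, y μ • γ μ) * (∑ μ, y μ • γ μ)) =
        (2 : ℝ) • ((∑ μ, y μ ^ 2) • (1 : A)) := by
      calc _ = ∑ μ, ∑ ν, (y μ * y ν) • (γ μ * γ ν) + ∑ μ, ∑ ν, (y μ * y ν) • (γ μ * γ ν) := by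
            rw [two_smul, Finset.sum_mul_sum]
            simp only [smul_mul_smul_comm]
        _ = ∑ μ, ∑ ν, (y μ * y ν) • (γ μ * γ ν) + ∑ μ, ∑ ν, (y μ * y ν) • (γ ν * γ μ) := by
            congr 1
            rw [Finset.sum_comm]
            simp only [mul_comm]
        _ = ∑ μ, ∑ ν, (y μ * y ν) • (if μ = ν then (2 : A) else 0) := by
            simp only [← Finset.sum_add_distrib, ← smul_add, hγ.anticomm]
        _ = _ := by
            simp only [smul_ite, smul_zero, Finset.sum_ite_eq, Finset.mem_univ, if_true]
            rw [Finset.sum_smul, Finset.smul_sum]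
            refine Finset.sum_congr rfl fun μ _ => ?_
            rw [smul_comm, two_smul ℝ (1 : A), one_add_one_eq_two, sq]
    exact smul_right_injective A (two_ne_zero (α := ℝ)) h2
  have h := CStarRing.norm_star_mul_self (x := ∑ μ, y μ • γ μ)
  rw [hstar, hsq, norm_smul, norm_one, mul_one, Real.norm_of_nonneg (by positivity)] at h
  rw [sq, h]

theorem comm_mul_mem_span (hγ : IsMajorana γ) (μ ν : ι) {w : A}
    (hw : w ∈ Submodule.span ℝ (Set.range γ)) :
    γ μ * γ ν * w - w * (γ μ * γ ν) ∈ Submodule.span ℝ (Set.range γ) := by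
  induction hw using Submodule.span_induction with
  | mem x hx =>
    obtain ⟨ρ, rfl⟩ := hx
    -- The identity `[ab, c] = a{b, c} - {a, c}b` lowers the degree to one.
    have h : γ μ * γ ν * γ ρ - γ ρ * (γ μ * γ ν) =
        γ μ * (γ ν * γ ρ + γ ρ * γ ν) - (γ μ * γ ρ + γ ρ * γ μ) * γ ν := by noncomm_ring
    have h2 : ∀ (σ : ι), γ σ * 2 ∈ Submodule.span ℝ (Set.range γ) ∧
        2 * γ σ ∈ Submodule.span ℝ (Set.range γ) := fun σ => by
      have := Submodule.subset_span (R := ℝ) (Set.mem_range_self (f := γ) σ)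
      rw [mul_two, two_mul]
      exact ⟨Submodule.add_mem _ this this, Submodule.add_mem _ this this⟩
    rw [h, hγ.anticomm, hγ.anticomm]
    refine Submodule.sub_mem _ ?_ ?_
    · split_ifs
      · exact (h2 μ).1
      · simp
    · split_ifs
      · exact (h2 ν).2
      · simp
  | zero => simp
  | add x y _ _ hx hy =>
    convert! Submodule.add_mem _ hx hy using 1
    noncomm_ring
  | smul r x _ hx =>
    convert! Submodule.smul_mem _ r hx using 1
    rw [mul_smul_comm, smul_mul_assoc, smul_sub]

end IsMajorana

/-- The generators whose commutators preserve the real span of `γ`. -/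
def PreservesSpan {ι : Type*} (γ : ι → A) (G : A) : Prop :=
  ∀ w ∈ Submodule.span ℝ (Set.range γ), G * w - w * G ∈ Submodule.span ℝ (Set.range γ)

namespace PreservesSpan

variable {ι : Type*} {γ : ι → A}

theorem add {G G' : A} (h : PreservesSpan γ G) (h' : PreservesSpan γ G') :
    PreservesSpan γ (G + G') := fun w hw => by
  convert! Submodule.add_mem _ (h w hw) (h' w hw) using 1
  noncomm_ring

theorem smul {G : A} (r : ℝ) (h : PreservesSpan γ G) : PreservesSpan γ ((r : ℂ) • G) :=
  fun w hw => by
  convert! Submodule.smul_mem _ r (h w hw) using 1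
  rw [Complex.coe_smul, mul_smul_comm, smul_mul_assoc, smul_sub]

theorem sum {κ : Type*} (s : Finset κ) {G : κ → A} (h : ∀ k ∈ s, PreservesSpan γ (G k)) :
    PreservesSpan γ (∑ k ∈ s, G k) := by
  refine Finset.sum_induction _ _ (fun _ _ => add) ?_ h
  intro w _
  simp

end PreservesSpan

variable {n : Type*} [Fintype n] [DecidableEq n] {γ : n ⊕ n → A}

/-- In the Euclidean coordinates of the span the commutator is block diagonal: it swaps the two
coordinates of the site `j` with factors `±2 δ j`. Its norm is thus governed by the supremum of `|δ
j|`, not by a sum over sites. -/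
theorem IsMajorana.norm_comm_sum_le [Nontrivial A] (hγ : IsMajorana γ) (δ : n → ℝ) {ε : ℝ}
    (hε : 0 ≤ ε) (hδ : ∀ j, |δ j| ≤ ε) {w : A} (hw : w ∈ Submodule.span ℝ (Set.range γ)) :
    ‖(∑ j, (δ j : ℂ) • (γ (.inl j) * γ (.inr j))) * w -
      w * ∑ j, (δ j : ℂ) • (γ (.inl j) * γ (.inr j))‖ ≤ 2 * ε * ‖w‖ := by
  obtain ⟨y, rfl⟩ := (Submodule.mem_span_range_iff_exists_fun ℝ).1 hw
  have hcomm : ∀ j μ, γ (.inl j) * γ (.inr j) * γ μ - γ μ * (γ (.inl j) * γ (.inr j)) =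
      (if .inr j = μ then (2 : ℝ) else 0) • γ (.inl j) -
        (if .inl j = μ then (2 : ℝ) else 0) • γ (.inr j) := by
    intro j μ
    have h : γ (.inl j) * γ (.inr j) * γ μ - γ μ * (γ (.inl j) * γ (.inr j)) =
        γ (.inl j) * (γ (.inr j) * γ μ + γ μ * γ (.inr j)) -
          (γ (.inl j) * γ μ + γ μ * γ (.inl j)) * γ (.inr j) := by noncomm_ring
    rw [h, hγ.anticomm, hγ.anticomm]
    split_ifs <;> simp [mul_two, two_mul, two_smul]
  let z : n ⊕ n → ℝ := Sum.elim (fun j => 2 * δ j * y (.inr j)) (fun j => -(2 * δ j * y (.inl j)))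
  have key : (∑ j, (δ j : ℂ) • (γ (.inl j) * γ (.inr j))) * (∑ μ, y μ • γ μ) -
      (∑ μ, y μ • γ μ) * (∑ j, (δ j : ℂ) • (γ (.inl j) * γ (.inr j))) = ∑ μ, z μ • γ μ := by
    simp only [Complex.coe_smul]
    rw [Finset.sum_mul_sum, Finset.sum_mul_sum, Finset.sum_comm (s := Finset.univ (α := n ⊕ n)),
      ← Finset.sum_sub_distrib, Fintype.sum_sum_type, ← Finset.sum_add_distrib]
    refine Finset.sum_congr rfl fun j _ => ?_
    rw [← Finset.sum_sub_distrib]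
    have : ∀ μ, δ j • (γ (.inl j) * γ (.inr j)) * y μ • γ μ -
        y μ • γ μ * δ j • (γ (.inl j) * γ (.inr j)) =
        (if .inr j = μ then (δ j * y μ * 2) • γ (.inl j) else 0) -
        (if .inl j = μ then (δ j * y μ * 2) • γ (.inr j) else 0) := by
      intro μ
      rw [smul_mul_smul_comm, smul_mul_smul_comm, mul_comm (y μ), ← smul_sub, hcomm, smul_sub,
        smul_smul, smul_smul]
      split_ifs <;> simp
    rw [Finset.sum_congr rfl fun μ _ => this μ, Finset.sum_sub_distrib]
    simp only [Finset.sum_ite_eq, Finset.mem_univ, if_true, z, Sum.elim_inl, Sum.elim_inr,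
      neg_smul, sub_eq_add_neg]
    module
  rw [key]
  refine (sq_le_sq₀ (norm_nonneg _) (by positivity)).1 ?_
  rw [mul_pow, hγ.norm_sum_smul_sq, hγ.norm_sum_smul_sq, Fintype.sum_sum_type,
    Fintype.sum_sum_type, add_comm (∑ j, y (.inl j) ^ 2), mul_add, Finset.mul_sum, Finset.mul_sum]
  have hle : ∀ j (r : ℝ), (2 * δ j * r) ^ 2 ≤ (2 * ε) ^ 2 * r ^ 2 := fun j r => by
    rw [mul_pow]
    have : (2 * δ j) ^ 2 ≤ (2 * ε) ^ 2 := by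
      rw [sq_le_sq, abs_mul, abs_mul, abs_of_nonneg hε]
      exact mul_le_mul_of_nonneg_left (hδ j) (abs_nonneg _)
    gcongr
  refine add_le_add (Finset.sum_le_sum fun j _ => hle j _) (Finset.sum_le_sum fun j _ => ?_)
  simpa [z] using hle j (y (.inl j))

/-- The evolutions of a Majorana element under two quadratic generators that differ by the on-site
terms `δ` differ by at most `2 |t| sup |δ|`. -/
theorem IsMajorana.norm_heis_sub_heis_le [Nontrivial A] (hγ : IsMajorana γ) {G₁ G₂ : A}
    (h₁ : star G₁ = -G₁) (h₂ : star G₂ = -G₂) (hG : PreservesSpan γ G₁) (δ : n → ℝ)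
    (hd : G₁ - G₂ = ∑ j, (δ j : ℂ) • (γ (.inl j) * γ (.inr j))) {ε : ℝ}
    (hε : 0 ≤ ε) (hδ : ∀ j, |δ j| ≤ ε) (t : ℝ) (μ : n ⊕ n) :
    ‖heis G₁ t (γ μ) - heis G₂ t (γ μ)‖ ≤ 2 * ε * |t| := by
  have : FiniteDimensional ℝ (Submodule.span ℝ (Set.range γ)) :=
    FiniteDimensional.span_of_finite ℝ (Set.finite_range γ)
  have h := IsingQuench.norm_heis_sub_heis_le h₁ h₂ (Submodule.span ℝ (Set.range γ)) hG
    (κ := 2 * ε) (fun w hw => by rw [hd]; exact hγ.norm_comm_sum_le δ hε hδ hw) t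
    (Submodule.subset_span (Set.mem_range_self μ))
  rwa [hγ.norm_eq_one, mul_one] at h

/-- Contractions whose evolutions under `G₁` and `G₂` up to time `t` differ by at most `r`. -/
structure HeisClose (G₁ G₂ : A) (t : ℝ) (c : A) (r : ℝ) : Prop where
  norm_le : ‖c‖ ≤ 1
  norm_sub_le : ‖heis G₁ t c - heis G₂ t c‖ ≤ r

namespace HeisClose

variable {G₁ G₂ : A} {t : ℝ}

theorem one [Nontrivial A] : HeisClose G₁ G₂ t 1 0 := ⟨by simp, by simp [heis_one]⟩

theorem mono {c : A} {r s : ℝ} (h : HeisClose G₁ G₂ t c r) (hrs : r ≤ s) :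
    HeisClose G₁ G₂ t c s := ⟨h.norm_le, h.norm_sub_le.trans hrs⟩

theorem smul {c : A} {r : ℝ} (h : HeisClose G₁ G₂ t c r) {z : ℂ} (hz : ‖z‖ = 1) :
    HeisClose G₁ G₂ t (z • c) r :=
  ⟨by rw [norm_smul, hz, one_mul]; exact h.norm_le, by
    rw [heis_smul, heis_smul, ← smul_sub, norm_smul, hz, one_mul]; exact h.norm_sub_le⟩

/-- Telescoping: the factors are contractions and both evolutions are isometric, so errors add
without amplification. -/
theorem mul (h₁ : star G₁ = -G₁) (h₂ : star G₂ = -G₂) {c c' : A} {r r' : ℝ}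
    (h : HeisClose G₁ G₂ t c r) (h' : HeisClose G₁ G₂ t c' r') :
    HeisClose G₁ G₂ t (c * c') (r + r') := by
  refine ⟨(norm_mul_le _ _).trans (mul_le_one₀ h.norm_le (norm_nonneg _) h'.norm_le), ?_⟩
  have e : heis G₁ t (c * c') - heis G₂ t (c * c') =
      (heis G₁ t c - heis G₂ t c) * heis G₁ t c' + heis G₂ t c * (heis G₁ t c' - heis G₂ t c') := by
    rw [heis_mul, heis_mul]; noncomm_ring
  rw [e]
  refine (norm_add_le _ _).trans (add_le_add ?_ ?_)
  · refine (norm_mul_le _ _).trans ?_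
    rw [norm_heis h₁]
    exact (mul_le_of_le_one_right (norm_nonneg _) h'.norm_le).trans h.norm_sub_le
  · refine (norm_mul_le _ _).trans ?_
    rw [norm_heis h₂]
    exact (mul_le_of_le_one_left (norm_nonneg _) h.norm_le).trans h'.norm_sub_le

end HeisClose

end Majorana

/-! ### Spin operators, parity and the Jordan-Wigner transformation. -/

section Spins

variable {N : ℕ}

/-- The eigenvalue of `σᶻ` on a basis state. -/
def zSign (a : Fin 2) : ℂ := if a = 0 then 1 else -1

theorem zSign_mul_self (a : Fin 2) : zSign a * zSign a = 1 := by
  unfold zSign; split_ifs <;> simp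

theorem zSign_add_one (a : Fin 2) : zSign (a + 1) = -zSign a := by
  fin_cases a <;> simp [zSign]

theorem star_zSign (a : Fin 2) : star (zSign a) = zSign a := by
  unfold zSign; split_ifs <;> simp

/-- The product of `σᶻ` over the sites in `F`. -/
noncomputable def zString (F : Finset (Fin N)) : Op N :=
  Matrix.diagonal fun s => ∏ k ∈ F, zSign (s k)

/-- The configuration with the spin at `j` flipped. -/
def flipAt (j : Fin N) (s : Config N) : Config N := Function.update s j (s j + 1)

theorem flipAt_self (j : Fin N) (s : Config N) : flipAt j s j = s j + 1 := by simp [flipAt]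

theorem flipAt_of_ne {j k : Fin N} (h : k ≠ j) (s : Config N) : flipAt j s k = s k := by
  simp [flipAt, h]

theorem flipAt_flipAt (j : Fin N) (s : Config N) : flipAt j (flipAt j s) = s := by
  have h : ∀ a : Fin 2, a + 1 + 1 = a := by decide
  simp [flipAt, h]

theorem flipAt_comm (j k : Fin N) (s : Config N) :
    flipAt j (flipAt k s) = flipAt k (flipAt j s) := by
  rcases eq_or_ne j k with rfl | h
  · rfl
  · simp only [flipAt]
    rw [Function.update_of_ne h, Function.update_of_ne h.symm, Function.update_comm h]

theorem sigmaX_apply (j : Fin N) (s s' : Config N) :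
    sigmaX j s s' = if s' = flipAt j s then 1 else 0 := by
  have hx : ∀ a b : Fin 2, pauliX a b = if b = a + 1 then 1 else 0 := by
    intro a b
    fin_cases a <;> fin_cases b <;> simp [pauliX]
  simp only [sigmaX, siteOp, Matrix.of_apply, hx]
  rw [← ite_and]
  refine if_congr ⟨fun ⟨h1, h2⟩ => ?_, ?_⟩ rfl rfl
  · ext k : 1
    rcases eq_or_ne k j with rfl | hk
    · rw [h2, flipAt_self]
    · rw [flipAt_of_ne hk, h1 k hk]
  · rintro rfl
    exact ⟨fun k hk => (flipAt_of_ne hk s).symm, flipAt_self j s⟩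

theorem sigmaX_mul_apply (j : Fin N) (M : Op N) (s s' : Config N) :
    (sigmaX j * M) s s' = M (flipAt j s) s' := by
  simp [Matrix.mul_apply, sigmaX_apply]

theorem sigmaZ_eq (j : Fin N) : sigmaZ j = zString {j} := by
  have hz : ∀ a b : Fin 2, pauliZ a b = if a = b then zSign a else 0 := by
    intro a b
    fin_cases a <;> fin_cases b <;> simp [pauliZ, zSign]
  ext s s'
  simp only [sigmaZ, siteOp, Matrix.of_apply, hz, zString, Finset.prod_singleton,
    Matrix.diagonal_apply]
  rw [← ite_and]
  refine if_congr ⟨fun ⟨h1, h2⟩ => ?_, ?_⟩ rfl rfl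
  · ext k : 1
    rcases eq_or_ne k j with rfl | hk
    · exact h2
    · exact h1 k hk
  · rintro rfl
    exact ⟨fun _ _ => rfl, rfl⟩

theorem sigmaX_mul_self (j : Fin N) : sigmaX j * sigmaX j = 1 := by
  ext s s'
  rw [sigmaX_mul_apply, sigmaX_apply, flipAt_flipAt, Matrix.one_apply]
  simp only [eq_comm]

theorem sigmaX_comm (j k : Fin N) : sigmaX j * sigmaX k = sigmaX k * sigmaX j := by
  ext s s'
  rw [sigmaX_mul_apply, sigmaX_mul_apply, sigmaX_apply, sigmaX_apply, flipAt_comm]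

theorem star_sigmaX (j : Fin N) : star (sigmaX j) = sigmaX j := by
  ext s s'
  rw [Matrix.star_apply, sigmaX_apply, sigmaX_apply]
  have : s = flipAt j s' ↔ s' = flipAt j s :=
    ⟨fun h => by rw [h, flipAt_flipAt], fun h => by rw [h, flipAt_flipAt]⟩
  simp only [this]
  split_ifs <;> simp

theorem zString_comm (F G : Finset (Fin N)) : zString F * zString G = zString G * zString F := by
  simp only [zString, Matrix.diagonal_mul_diagonal, mul_comm]

theorem zString_mul_self (F : Finset (Fin N)) : zString F * zString F = 1 := by
  simp [zString, Matrix.diagonal_mul_diagonal, ← Finset.prod_mul_distrib, zSign_mul_self]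

theorem zString_empty : zString (∅ : Finset (Fin N)) = 1 := by simp [zString]

theorem zString_insert {F : Finset (Fin N)} {j : Fin N} (h : j ∉ F) :
    zString (insert j F) = zString {j} * zString F := by
  simp [zString, Finset.prod_insert h]

theorem star_zString (F : Finset (Fin N)) : star (zString F) = zString F := by
  rw [zString, Matrix.star_eq_conjTranspose, Matrix.diagonal_conjTranspose]
  congr 1
  ext s
  simp only [Pi.star_apply, star_prod, star_zSign]

/-- The sign of moving `σˣ_j` through the `σᶻ` string on `F`. -/
noncomputable def exchSign (j : Fin N) (F : Finset (Fin N)) : ℂ := if j ∈ F then -1 else 1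

theorem sigmaX_mul_zString (j : Fin N) (F : Finset (Fin N)) :
    sigmaX j * zString F = exchSign j F • (zString F * sigmaX j) := by
  have hprod : ∀ s : Config N,
      ∏ k ∈ F, zSign (flipAt j s k) = exchSign j F * ∏ k ∈ F, zSign (s k) := by
    intro s
    unfold exchSign
    split_ifs with h
    · rw [← Finset.mul_prod_erase _ _ h, ← Finset.mul_prod_erase _ _ h, flipAt_self, zSign_add_one,
        Finset.prod_congr rfl fun k hk => by rw [flipAt_of_ne (Finset.ne_of_mem_erase hk)]]
      ring
    · rw [one_mul]
      refine Finset.prod_congr rfl fun k hk => ?_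
      rw [flipAt_of_ne (by rintro rfl; exact h hk)]
  ext s s'
  rw [sigmaX_mul_apply, zString, Matrix.smul_apply, Matrix.diagonal_mul, sigmaX_apply,
    Matrix.diagonal_apply, hprod]
  simp only [@eq_comm _ s']
  split_ifs <;> simp

/-- This normal form reduces the Jordan-Wigner algebra to bookkeeping of one exchange sign. -/
theorem string_mul_string (F G : Finset (Fin N)) (j k : Fin N) :
    zString F * sigmaX j * (zString G * sigmaX k) =
      exchSign j G • (zString F * zString G * (sigmaX j * sigmaX k)) := by
  calc _ = zString F * (sigmaX j * zString G) * sigmaX k := by noncomm_ring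
    _ = _ := by
      rw [sigmaX_mul_zString, mul_smul_comm, smul_mul_assoc]
      congr 1
      noncomm_ring

theorem star_string (F : Finset (Fin N)) (j : Fin N) :
    star (zString F * sigmaX j) = exchSign j F • (zString F * sigmaX j) := by
  rw [star_mul, star_sigmaX, star_zString, sigmaX_mul_zString]

/-- The Jordan-Wigner Majorana operators. -/
noncomputable def majorana : Fin N ⊕ Fin N → Op N :=
  Sum.elim (fun j => zString (Finset.Iio j) * sigmaX j)
    -- The closed string puts `σᶻσˣ = i σʸ` at `j`; the factor `-i` makes the operator self-adjoint.
    (fun j => (-Complex.I) • (zString (Finset.Iic j) * sigmaX j))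

theorem majorana_inl_mul_inr (j : Fin N) :
    majorana (.inl j) * majorana (.inr j) = Complex.I • sigmaZ j := by
  simp only [majorana, Sum.elim_inl, Sum.elim_inr]
  have h : (Finset.Iic j) = insert j (Finset.Iio j) := by
    ext k; simp [le_iff_eq_or_lt]
  rw [mul_smul_comm, string_mul_string, sigmaX_mul_self, mul_one, h, zString_insert (by simp),
    ← mul_assoc, zString_comm _ {j}, mul_assoc, zString_mul_self, mul_one, sigmaZ_eq, exchSign,
    if_pos (by simp), smul_smul]
  simp

/-- The parity operator. -/
noncomputable def parity (N : ℕ) : Op N := zString Finset.univ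

theorem parity_mul_self : parity N * parity N = 1 := zString_mul_self _

theorem sigmaX_mul_parity (j : Fin N) : sigmaX j * parity N = -(parity N * sigmaX j) := by
  rw [parity, sigmaX_mul_zString, exchSign, if_pos (by simp)]
  simp

theorem sigmaX_mul_sigmaX_commute_parity (j k : Fin N) :
    Commute (sigmaX j * sigmaX k) (parity N) := by
  rw [Commute, SemiconjBy, mul_assoc, sigmaX_mul_parity, mul_neg, ← mul_assoc, sigmaX_mul_parity]
  noncomm_ring

theorem sigmaZ_commute_parity (j : Fin N) : Commute (sigmaZ j) (parity N) := by
  rw [sigmaZ_eq]; exact zString_comm _ _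

theorem majorana_mul_parity (μ : Fin N ⊕ Fin N) :
    majorana μ * parity N = -(parity N * majorana μ) := by
  have h : ∀ F (j : Fin N), zString F * sigmaX j * parity N =
      -(parity N * (zString F * sigmaX j)) := by
    intro F j
    rw [mul_assoc, sigmaX_mul_parity, mul_neg, ← mul_assoc, ← mul_assoc, parity, zString_comm]
  cases μ with
  | inl j => exact h _ _
  | inr j => simp only [majorana, Sum.elim_inr, smul_mul_assoc, mul_smul_comm, h, smul_neg]

theorem majorana_mul_commute_parity (μ ν : Fin N ⊕ Fin N) :
    Commute (majorana μ * majorana ν) (parity N) := by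
  rw [Commute, SemiconjBy, mul_assoc, majorana_mul_parity, mul_neg, ← mul_assoc,
    majorana_mul_parity]
  noncomm_ring

/-- Twice the projection to the sector of even parity. -/
noncomputable def evenProj (N : ℕ) : Op N := 1 + parity N

theorem parity_mul_evenProj : parity N * evenProj N = evenProj N := by
  rw [evenProj, mul_add, parity_mul_self, mul_one, add_comm]

theorem commute_evenProj {O : Op N} (h : Commute O (parity N)) : Commute O (evenProj N) :=
  (Commute.one_right O).add_right h

open scoped Matrix.Norms.L2Operator

/-- For two different operators exactly one string contains the site of the other's `σˣ`, so the two
exchange signs are opposite and the anticommutator vanishes. -/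
theorem isMajorana_majorana : IsMajorana (majorana (N := N)) where
  star_eq μ := by
    cases μ with
    | inl j =>
      simp only [majorana, Sum.elim_inl]
      rw [star_string, exchSign, if_neg (by simp), one_smul]
    | inr j =>
      simp only [majorana, Sum.elim_inr]
      rw [star_smul, star_string, exchSign, if_pos (by simp), smul_smul]
      simp
  anticomm μ ν := by
    have h : ∀ F G (j k : Fin N), zString F * sigmaX j * (zString G * sigmaX k) +
        zString G * sigmaX k * (zString F * sigmaX j) =
        (exchSign j G + exchSign k F) • (zString F * zString G * (sigmaX j * sigmaX k)) := by
      intro F G j k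
      rw [string_mul_string, string_mul_string, zString_comm G, sigmaX_comm k, add_smul]
    have h2 : ((2 : ℂ) • (1 : Op N)) = 2 := by rw [two_smul]; norm_num
    cases μ with
    | inl j => cases ν with
      | inl k =>
        simp only [majorana, Sum.elim_inl, Sum.inl.injEq]
        rw [h, exchSign, exchSign]
        simp only [Finset.mem_Iio]
        rcases lt_trichotomy j k with h1 | h1 | h1
        · rw [if_pos h1, if_neg h1.not_gt, if_neg h1.ne]; simp
        · subst h1
          rw [if_neg (lt_irrefl j), if_pos rfl, zString_mul_self, sigmaX_mul_self, one_mul,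
            one_add_one_eq_two, h2]
        · rw [if_neg h1.not_gt, if_pos h1, if_neg h1.ne']; simp
      | inr k =>
        simp only [majorana, Sum.elim_inl, Sum.elim_inr, reduceCtorEq, if_false]
        rw [mul_smul_comm, smul_mul_assoc, ← smul_add, h, exchSign, exchSign]
        simp only [Finset.mem_Iio, Finset.mem_Iic]
        rcases le_or_gt j k with h1 | h1
        · rw [if_pos h1, if_neg h1.not_gt]; simp
        · rw [if_neg h1.not_ge, if_pos h1]; simp
    | inr j => cases ν with
      | inl k =>
        simp only [majorana, Sum.elim_inl, Sum.elim_inr, reduceCtorEq, if_false]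
        rw [mul_smul_comm, smul_mul_assoc, ← smul_add, h, exchSign, exchSign]
        simp only [Finset.mem_Iio, Finset.mem_Iic]
        rcases le_or_gt k j with h1 | h1
        · rw [if_pos h1, if_neg h1.not_gt]; simp
        · rw [if_neg h1.not_ge, if_pos h1]; simp
      | inr k =>
        simp only [majorana, Sum.elim_inr, Sum.inr.injEq]
        rw [smul_mul_smul_comm, smul_mul_smul_comm, ← smul_add, h, exchSign, exchSign]
        simp only [Finset.mem_Iic]
        rcases lt_trichotomy j k with h1 | h1 | h1
        · rw [if_pos h1.le, if_neg h1.not_ge, if_neg h1.ne]; simp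
        · subst h1
          rw [if_pos le_rfl, if_pos rfl, zString_mul_self, sigmaX_mul_self, one_mul, smul_smul,
            ← h2]
          congr 1
          rw [neg_mul_neg, Complex.I_mul_I]
          norm_num
        · rw [if_neg h1.not_ge, if_pos h1.le, if_neg h1.ne']; simp

/-! ### The Hamiltonian on the even sector as a quadratic form. -/

variable [NeZero N]

/-- The sign of the bond from `j` to `j + 1`: antiperiodic boundary conditions. -/
def bondSign (j : Fin N) : ℝ := if j.val + 1 = N then -1 else 1

/-- Inside the chain the two strings coincide and cancel. At the last site `j + 1 = 0` has an empty
string and that of `j` is the whole parity. -/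
theorem majorana_inr_mul_inl (j : Fin N) :
    majorana (.inr j) * majorana (.inl (j + 1)) = if j.val + 1 = N then
      (-Complex.I) • (parity N * (sigmaX j * sigmaX (j + 1))) else
      Complex.I • (sigmaX j * sigmaX (j + 1)) := by
  simp only [majorana, Sum.elim_inl, Sum.elim_inr]
  have hv : (j + 1).val = (j.val + 1) % N := by
    rw [Fin.val_add, Fin.val_one', Nat.add_mod_mod]
  rw [smul_mul_assoc, string_mul_string, smul_smul]
  split_ifs with h
  · have h0 : Finset.Iio (j + 1) = ∅ := by
      ext k
      rw [h, Nat.mod_self] at hv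
      simp [Fin.lt_def, hv]
    have h1 : Finset.Iic j = Finset.univ := by
      ext k
      have := k.isLt
      simp only [Finset.mem_Iic, Fin.le_def, Finset.mem_univ, iff_true]
      omega
    rw [h0, h1, exchSign, if_neg (by simp), zString_empty, mul_one, mul_one, parity]
  · have h1 : Finset.Iio (j + 1) = Finset.Iic j := by
      ext k
      have := j.isLt
      rw [Nat.mod_eq_of_lt (by omega)] at hv
      simp only [Finset.mem_Iio, Finset.mem_Iic, Fin.lt_def, Fin.le_def]
      omega
    rw [h1, exchSign, if_pos (by simp), zString_mul_self, one_mul]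
    simp

/-- The generator `i H` of the evolution in the sector of even parity, as a quadratic form in the
Majorana operators. -/
noncomputable def evenGen (f : Fin N → ℝ) : Op N :=
  ∑ j, ((-bondSign j : ℝ) : ℂ) • (majorana (.inr j) * majorana (.inl (j + 1))) +
    ∑ j, (f j : ℂ) • (majorana (.inl j) * majorana (.inr j))

/-- The bond operator `σˣ_j σˣ_{j+1}` in the sector of even parity. -/
noncomputable def evenBond (j : Fin N) : Op N :=
  (-Complex.I * bondSign j) • (majorana (.inr j) * majorana (.inl (j + 1)))

/-- Parity acts as the identity on the range of `evenProj`, so the closing bond is quadratic there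
too, with the opposite sign. -/
theorem bond_mul_evenProj (j : Fin N) :
    sigmaX j * sigmaX (j + 1) * evenProj N = evenBond j * evenProj N := by
  have hI : -Complex.I * Complex.I = 1 := by simp
  rw [evenBond, majorana_inr_mul_inl, bondSign]
  split_ifs with h
  · rw [smul_smul, ← (sigmaX_mul_sigmaX_commute_parity j (j + 1)).eq, smul_mul_assoc,
      mul_assoc _ (parity N), parity_mul_evenProj]
    simp
  · rw [smul_smul]
    simp

theorem hamiltonian_mul_evenProj (f : Fin N → ℝ) :
    (Complex.I • hamiltonian f) * evenProj N = evenGen f * evenProj N := by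
  rw [hamiltonian, evenGen, smul_add, add_mul, add_mul]
  congr 1
  · rw [smul_neg, neg_mul, smul_mul_assoc, Finset.sum_mul, Finset.sum_mul, Finset.smul_sum,
      ← Finset.sum_neg_distrib]
    refine Finset.sum_congr rfl fun j _ => ?_
    rw [bond_mul_evenProj, evenBond, smul_mul_assoc, smul_mul_assoc, smul_smul, ← neg_smul]
    congr 1
    rw [← mul_assoc]
    simp
  · congr 1
    rw [Finset.smul_sum]
    refine Finset.sum_congr rfl fun j _ => ?_
    rw [majorana_inl_mul_inr, smul_comm]

theorem evenGen_commute (f : Fin N → ℝ) : Commute (evenGen f) (evenProj N) := by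
  refine commute_evenProj (Commute.add_left ?_ ?_)
  · exact Commute.sum_left _ _ _ fun j _ => (majorana_mul_commute_parity _ _).smul_left _
  · exact Commute.sum_left _ _ _ fun j _ => (majorana_mul_commute_parity _ _).smul_left _

theorem evenBond_commute (j : Fin N) : Commute (evenBond j) (evenProj N) :=
  commute_evenProj ((majorana_mul_commute_parity _ _).smul_left _)

theorem hamiltonian_commute_parity (f : Fin N → ℝ) : Commute (hamiltonian f) (parity N) := by
  refine Commute.add_left (Commute.neg_left ?_) ?_
  · exact Commute.sum_left _ _ _ fun j _ => sigmaX_mul_sigmaX_commute_parity _ _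
  · exact Commute.sum_left _ _ _ fun j _ => (sigmaZ_commute_parity j).smul_left _

theorem star_evenGen (f : Fin N → ℝ) : star (evenGen f) = -evenGen f := by
  have h : ∀ (r : ℝ) {μ ν : Fin N ⊕ Fin N}, μ ≠ ν →
      star ((r : ℂ) • (majorana μ * majorana ν)) = -((r : ℂ) • (majorana μ * majorana ν)) := by
    intro r μ ν hne
    rw [star_smul, star_mul, isMajorana_majorana.star_eq, isMajorana_majorana.star_eq,
      isMajorana_majorana.mul_swap hne.symm, smul_neg]
    simp
  rw [evenGen, star_add, star_sum, star_sum, neg_add, ← Finset.sum_neg_distrib,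
    ← Finset.sum_neg_distrib]
  congr 1 <;> exact Finset.sum_congr rfl fun j _ => h _ (by simp)

theorem preservesSpan_evenGen (f : Fin N → ℝ) : PreservesSpan majorana (evenGen f) := by
  have h : ∀ (r : ℝ) (μ ν : Fin N ⊕ Fin N),
      PreservesSpan majorana ((r : ℂ) • (majorana μ * majorana ν)) := fun r μ ν =>
    PreservesSpan.smul r fun w hw => isMajorana_majorana.comm_mul_mem_span μ ν hw
  exact (PreservesSpan.sum _ fun j _ => h _ _ _).add (PreservesSpan.sum _ fun j _ => h _ _ _)

end Spins

/-! ### Reduction of averages to the even sector, and bounds on correlators. -/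

section Correlators

open scoped Matrix.Norms.L2Operator

theorem prod_zSign_mul_rightState {N : ℕ} (s : Config N) :
    (∏ k, zSign (s k)) * rightState N s = leftState N s := by
  rw [rightState, leftState, ← Finset.prod_mul_distrib]
  refine Finset.prod_congr rfl fun k _ => ?_
  unfold zSign
  split_ifs <;> simp

theorem parity_mulVec_catState (N : ℕ) : parity N *ᵥ catState N = catState N := by
  ext s
  have h : (∏ k, zSign (s k)) * (∏ k, zSign (s k)) = 1 := by
    simp [← Finset.prod_mul_distrib, zSign_mul_self]
  rw [parity, zString, Matrix.mulVec_diagonal, catState, Pi.smul_apply, Pi.add_apply,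
    ← prod_zSign_mul_rightState, smul_eq_mul]
  linear_combination (((1 / Real.sqrt 2 : ℝ) : ℂ)) * rightState N s * h

/-- A pointwise triangle inequality suffices, since only a bound uniform in `N` is needed. -/
theorem norm_catState_le (N : ℕ) : ‖WithLp.toLp 2 (catState N)‖ ^ 2 ≤ 2 := by
  have hr : ∀ s, ‖rightState N s‖ = (1 / Real.sqrt 2) ^ N := fun s => by
    simp [rightState, abs_of_pos]
  have hl : ∀ s, ‖leftState N s‖ = (1 / Real.sqrt 2) ^ N := fun s => by
    rw [← prod_zSign_mul_rightState, norm_mul, hr, norm_prod]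
    have : ∀ a, ‖zSign a‖ = 1 := fun a => by unfold zSign; split_ifs <;> simp
    simp [this]
  have hc : ∀ s, ‖catState N s‖ ^ 2 ≤ 2 * (1 / 2) ^ N := fun s => by
    have h2 : Real.sqrt 2 ^ 2 = 2 := Real.sq_sqrt (by norm_num)
    have h0 : (1 / Real.sqrt 2) ^ 2 = 1 / 2 := by rw [div_pow, h2, one_pow]
    have h1 : ‖catState N s‖ ≤ (1 / Real.sqrt 2) * (2 * (1 / Real.sqrt 2) ^ N) := by
      rw [catState, Pi.smul_apply, norm_smul, Complex.norm_real,
        Real.norm_of_nonneg (by positivity)]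
      gcongr
      exact (norm_add_le _ _).trans (by rw [hr, hl, two_mul])
    calc _ ≤ ((1 / Real.sqrt 2) * (2 * (1 / Real.sqrt 2) ^ N)) ^ 2 := by gcongr
      _ = 4 * (1 / Real.sqrt 2) ^ 2 * ((1 / Real.sqrt 2) ^ 2) ^ N := by ring
      _ = _ := by rw [h0]; ring
  rw [EuclideanSpace.norm_sq_eq]
  calc _ ≤ ∑ _s : Config N, 2 * (1 / 2 : ℝ) ^ N := Finset.sum_le_sum fun s _ => hc s
    _ = 2 := by
      rw [Finset.sum_const, Finset.card_univ]
      simp only [Fintype.card_pi, Fintype.card_fin, Finset.prod_const, Finset.card_univ,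
        nsmul_eq_mul, Nat.cast_pow, Nat.cast_ofNat]
      rw [mul_left_comm, ← mul_pow]
      norm_num

theorem norm_star_dotProduct_mulVec_le {n : Type*} [Fintype n] [DecidableEq n]
    (M : Matrix n n ℂ) (v : n → ℂ) :
    ‖star v ⬝ᵥ (M *ᵥ v)‖ ≤ ‖M‖ * ‖WithLp.toLp 2 v‖ ^ 2 := by
  have h : star v ⬝ᵥ (M *ᵥ v) = inner ℂ (WithLp.toLp 2 v) (WithLp.toLp 2 (M *ᵥ v)) := by
    rw [EuclideanSpace.inner_toLp_toLp, dotProduct_comm]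
  rw [h]
  refine (norm_inner_le_norm _ _).trans ?_
  have := M.l2_opNorm_mulVec (WithLp.toLp 2 v)
  calc _ ≤ ‖WithLp.toLp 2 v‖ * (‖M‖ * ‖WithLp.toLp 2 v‖) :=
        mul_le_mul_of_nonneg_left this (norm_nonneg _)
    _ = _ := by ring

variable {N : ℕ}

theorem abs_longWaveField_le {P : ℕ} {u v : Fin (P + 1) → ℝ} {c : ℝ}
    (h : ∀ p, |u p| ≤ c ∧ |v p| ≤ c) (j : Fin N) :
    |longWaveField N P u v j| ≤ (P + 1) * (2 * c) := by
  have hb : ∀ a b : ℝ, |b| ≤ 1 → |a| ≤ c → |a * b| ≤ c := fun a b hb ha => by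
    rw [abs_mul]; exact (mul_le_of_le_one_right (abs_nonneg _) hb).trans ha
  refine (Finset.abs_sum_le_sum_abs _ _).trans ?_
  calc _ ≤ ∑ _p : Fin (P + 1), 2 * c := Finset.sum_le_sum fun p _ => by
        refine (abs_add_le _ _).trans ?_
        rw [two_mul c]
        exact add_le_add (hb _ _ (Real.abs_cos_le_one _) (h p).1)
          (hb _ _ (Real.abs_sin_le_one _) (h p).2)
    _ = _ := by simp

theorem prod_sigmaX_mul_parity (L : ℕ) (i : Fin L → Fin N) :
    (List.ofFn fun a => sigmaX (i a)).prod * parity N =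
      (-1 : ℂ) ^ L • (parity N * (List.ofFn fun a => sigmaX (i a)).prod) := by
  induction L with
  | zero => simp
  | succ m ih =>
    rw [List.ofFn_succ, List.prod_cons, mul_assoc, ih (fun a => i a.succ), mul_smul_comm,
      ← mul_assoc, sigmaX_mul_parity, pow_succ, mul_neg_one, neg_smul, neg_mul,
      smul_neg, mul_assoc]

variable [NeZero N]

/-- `evenProj` intertwines the two generators, hence their exponentials, and the initial state is
its eigenvector with eigenvalue `2`. -/
theorem evolvedState_eq (f : Fin N → ℝ) (t : ℝ) :
    evolvedState f t = NormedSpace.exp (t • (-evenGen f)) *ᵥ catState N ∧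
      evenProj N *ᵥ evolvedState f t = (2 : ℂ) • evolvedState f t := by
  let := NormedAlgebra.restrictScalars ℚ ℂ (Op N)
  have hcat : evenProj N *ᵥ catState N = (2 : ℂ) • catState N := by
    rw [evenProj, Matrix.add_mulVec, Matrix.one_mulVec, parity_mulVec_catState, two_smul]
  have h1 : SemiconjBy (evenProj N) (t • (-evenGen f))
      ((-(Complex.I * (t : ℂ))) • hamiltonian f) := by
    have e : (-(Complex.I * (t : ℂ))) • hamiltonian f =
        (-(t : ℂ)) • (Complex.I • hamiltonian f) := by
      rw [smul_smul]; congr 1; ring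
    rw [SemiconjBy, e, smul_mul_assoc, hamiltonian_mul_evenProj, (evenGen_commute f).eq,
      ← Complex.coe_smul, mul_smul_comm, mul_neg, neg_smul, smul_neg]
  have h2 : Commute (evenProj N) (t • (-evenGen f)) :=
    ((evenGen_commute f).symm.neg_right).smul_right t
  have h1' := h1.exp_right.eq
  have h2' := h2.exp_right.eq
  have key : evolvedState f t = NormedSpace.exp (t • (-evenGen f)) *ᵥ catState N := by
    have : (2 : ℂ) • evolvedState f t =
        (2 : ℂ) • (NormedSpace.exp (t • (-evenGen f)) *ᵥ catState N) := by
      rw [evolvedState, ← Matrix.mulVec_smul, ← Matrix.mulVec_smul, ← hcat, Matrix.mulVec_mulVec,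
        Matrix.mulVec_mulVec, ← h2', h1']
    exact smul_right_injective _ (two_ne_zero (α := ℂ)) this
  refine ⟨key, ?_⟩
  rw [key, Matrix.mulVec_mulVec, h2', ← Matrix.mulVec_mulVec, hcat, Matrix.mulVec_smul]

/-- Averages of operators that agree on the sector of even parity are expectations of the evolution
generated by the quadratic form. -/
theorem average_eq (f : Fin N → ℝ) (t : ℝ) {O O' : Op N}
    (h : O * evenProj N = O' * evenProj N) :
    average f t O = star (catState N) ⬝ᵥ (heis (evenGen f) t O' *ᵥ catState N) := by
  obtain ⟨h1, h2⟩ := evolvedState_eq f t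
  have hO : O *ᵥ evolvedState f t = O' *ᵥ evolvedState f t := by
    refine smul_right_injective _ (two_ne_zero (α := ℂ)) ?_
    simp only
    rw [← Matrix.mulVec_smul, ← Matrix.mulVec_smul, ← h2, Matrix.mulVec_mulVec,
      Matrix.mulVec_mulVec, h]
  rw [average, hO, h1, Matrix.star_mulVec, ← Matrix.dotProduct_mulVec, Matrix.mulVec_mulVec,
    Matrix.mulVec_mulVec, heis,
    ← Matrix.star_eq_conjTranspose, star_exp_skew (by rw [star_neg, star_evenGen]), neg_neg,
    mul_assoc]

/-- An operator agreeing on the sector of even parity with a parity-conserving one whose evolutions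
are close. -/
def EvenClose (f g : Fin N → ℝ) (t : ℝ) (O : Op N) (r : ℝ) : Prop :=
  ∃ O' : Op N, O * evenProj N = O' * evenProj N ∧ Commute O' (evenProj N) ∧
    HeisClose (evenGen f) (evenGen g) t O' r

theorem EvenClose.norm_average_sub_le {f g : Fin N → ℝ} {t : ℝ} {O : Op N} {r : ℝ}
    (h : EvenClose f g t O r) : ‖average f t O - average g t O‖ ≤ 2 * r := by
  obtain ⟨O', hO, -, hc⟩ := h
  rw [average_eq f t hO, average_eq g t hO, ← dotProduct_sub, ← Matrix.sub_mulVec]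
  refine (norm_star_dotProduct_mulVec_le _ _).trans ?_
  have h1 := hc.norm_sub_le
  have h2 := norm_catState_le N
  calc _ ≤ r * 2 := mul_le_mul h1 h2 (by positivity) ((norm_nonneg _).trans h1)
    _ = _ := by ring

theorem EvenClose.one (f g : Fin N → ℝ) (t : ℝ) : EvenClose f g t 1 0 :=
  ⟨1, rfl, Commute.one_left _, HeisClose.one⟩

/-- Agreement on the even sector passes to products because the representative of the right factor
commutes with `evenProj`. -/
theorem EvenClose.mul {f g : Fin N → ℝ} {t : ℝ} {O₁ O₂ : Op N} {r₁ r₂ : ℝ}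
    (h₁ : EvenClose f g t O₁ r₁) (h₂ : EvenClose f g t O₂ r₂) :
    EvenClose f g t (O₁ * O₂) (r₁ + r₂) := by
  obtain ⟨A₁, e₁, c₁, k₁⟩ := h₁
  obtain ⟨A₂, e₂, c₂, k₂⟩ := h₂
  refine ⟨A₁ * A₂, ?_, c₁.mul_left c₂, k₁.mul (star_evenGen f) (star_evenGen g) k₂⟩
  rw [mul_assoc, e₂, c₂.eq, ← mul_assoc, e₁, mul_assoc, mul_assoc, c₂.eq]

theorem EvenClose.mono {f g : Fin N → ℝ} {t : ℝ} {O : Op N} {r s : ℝ}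
    (h : EvenClose f g t O r) (hrs : r ≤ s) : EvenClose f g t O s := by
  obtain ⟨A, e, c, k⟩ := h
  exact ⟨A, e, c, k.mono hrs⟩

theorem heisClose_majorana {f g : Fin N → ℝ} {ε : ℝ} (hε : 0 ≤ ε)
    (hfg : ∀ j, |f j - g j| ≤ ε) (t : ℝ) (μ : Fin N ⊕ Fin N) :
    HeisClose (evenGen f) (evenGen g) t (majorana μ) (2 * ε * |t|) := by
  refine ⟨(isMajorana_majorana.norm_eq_one μ).le, isMajorana_majorana.norm_heis_sub_heis_le
    (star_evenGen f) (star_evenGen g) (preservesSpan_evenGen f) (fun j => f j - g j) ?_ hε hfg t μ⟩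
  rw [evenGen, evenGen, add_sub_add_left_eq_sub, ← Finset.sum_sub_distrib]
  simp only [Complex.ofReal_sub, sub_smul]

theorem evenClose_bond {f g : Fin N → ℝ} {ε : ℝ} (hε : 0 ≤ ε)
    (hfg : ∀ j, |f j - g j| ≤ ε) (t : ℝ) (j : Fin N) :
    EvenClose f g t (sigmaX j * sigmaX (j + 1)) (4 * ε * |t|) := by
  refine ⟨evenBond j, bond_mul_evenProj j, evenBond_commute j, HeisClose.smul ?_ ?_⟩
  · exact ((heisClose_majorana hε hfg t _).mul (star_evenGen f) (star_evenGen g)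
      (heisClose_majorana hε hfg t _)).mono (le_of_eq (by ring))
  · unfold bondSign
    split_ifs <;> simp

theorem evenClose_sigmaZ {f g : Fin N → ℝ} {ε : ℝ} (hε : 0 ≤ ε)
    (hfg : ∀ j, |f j - g j| ≤ ε) (t : ℝ) (j : Fin N) :
    EvenClose f g t (sigmaZ j) (4 * ε * |t|) := by
  have hz : sigmaZ j = (-Complex.I) • (majorana (.inl j) * majorana (.inr j)) := by
    rw [majorana_inl_mul_inr, smul_smul]; simp
  refine ⟨sigmaZ j, rfl, commute_evenProj (sigmaZ_commute_parity j), ?_⟩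
  rw [hz]
  refine HeisClose.smul ?_ (by simp)
  exact ((heisClose_majorana hε hfg t _).mul (star_evenGen f) (star_evenGen g)
    (heisClose_majorana hε hfg t _)).mono (le_of_eq (by ring))

/-- Inserting `σˣσˣ = 1` at the intermediate sites writes the pair as a product of the `m` bonds on
the arc from `j` up to `i`. -/
theorem evenClose_sigmaX_pair_of_val_sub {f g : Fin N → ℝ} {ε : ℝ} (hε : 0 ≤ ε)
    (hfg : ∀ j, |f j - g j| ≤ ε) (t : ℝ) (m : ℕ) (i j : Fin N) (h : (i - j).val = m) :
    EvenClose f g t (sigmaX j * sigmaX i) (m * (4 * ε * |t|)) := by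
  induction m generalizing j with
  | zero =>
    have : i = j := sub_eq_zero.1 (Fin.ext (by simpa using h))
    rw [this, sigmaX_mul_self]
    simpa using EvenClose.one f g t
  | succ m ih =>
    have hne : i - j ≠ 0 := fun e => by simp [e] at h
    have h' : (i - (j + 1)).val = m := by
      rw [← sub_sub, Fin.val_sub_one_of_ne_zero hne, h, Nat.add_sub_cancel]
    have e : sigmaX j * sigmaX i =
        sigmaX j * sigmaX (j + 1) * (sigmaX (j + 1) * sigmaX i) := by
      calc _ = sigmaX j * (sigmaX (j + 1) * sigmaX (j + 1)) * sigmaX i := by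
            rw [sigmaX_mul_self, mul_one]
        _ = _ := by noncomm_ring
    rw [e]
    refine ((evenClose_bond hε hfg t j).mul (ih (j + 1) h')).mono (le_of_eq ?_)
    push_cast
    ring

theorem evenClose_sigmaX_pair {f g : Fin N → ℝ} {ε : ℝ} (hε : 0 ≤ ε)
    (hfg : ∀ j, |f j - g j| ≤ ε) (t : ℝ) {d : ℕ} (i j : Fin N) (h : siteDist i j ≤ d) :
    EvenClose f g t (sigmaX i * sigmaX j) (d * (4 * ε * |t|)) := by
  have hd : ∀ {m : ℕ}, m ≤ d → (m : ℝ) * (4 * ε * |t|) ≤ d * (4 * ε * |t|) := fun hm => by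
    gcongr
  rcases min_le_iff.1 h with h | h
  · rw [sigmaX_comm]
    exact (evenClose_sigmaX_pair_of_val_sub hε hfg t _ i j rfl).mono (hd h)
  · exact (evenClose_sigmaX_pair_of_val_sub hε hfg t _ j i rfl).mono (hd h)

/-- Consecutive factors are paired off; each of the `m` pairs costs at most `d` bonds. -/
theorem evenClose_prod_sigmaX {f g : Fin N → ℝ} {ε : ℝ} (hε : 0 ≤ ε)
    (hfg : ∀ j, |f j - g j| ≤ ε) (t : ℝ) {d : ℕ} (m : ℕ) (i : Fin (2 * m) → Fin N)
    (hi : ∀ a b, siteDist (i a) (i b) ≤ d) :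
    EvenClose f g t (List.ofFn fun a => sigmaX (i a)).prod (m * (d * (4 * ε * |t|))) := by
  induction m with
  | zero => simpa using EvenClose.one f g t
  | succ m ih =>
    change Fin (2 * m + 1 + 1) → Fin N at i
    change EvenClose f g t (List.ofFn (n := 2 * m + 1 + 1) fun a => sigmaX (i a)).prod _
    rw [List.ofFn_succ, List.ofFn_succ, List.prod_cons, List.prod_cons, ← mul_assoc]
    refine ((evenClose_sigmaX_pair hε hfg t _ _ (hi _ _)).mul
      (ih (fun a => i a.succ.succ) fun a b => hi _ _)).mono (le_of_eq ?_)
    push_cast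
    ring

theorem evenClose_prod_sigmaZ {f g : Fin N → ℝ} {ε : ℝ} (hε : 0 ≤ ε)
    (hfg : ∀ j, |f j - g j| ≤ ε) (t : ℝ) (L : ℕ) (i : Fin L → Fin N) :
    EvenClose f g t (List.ofFn fun a => sigmaZ (i a)).prod (L * (4 * ε * |t|)) := by
  induction L with
  | zero => simpa using EvenClose.one f g t
  | succ m ih =>
    rw [List.ofFn_succ, List.prod_cons]
    refine ((evenClose_sigmaZ hε hfg t _).mul (ih fun a => i a.succ)).mono (le_of_eq ?_)
    push_cast
    ring

theorem parity_mulVec_evolvedState (f : Fin N → ℝ) (t : ℝ) :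
    parity N *ᵥ evolvedState f t = evolvedState f t := by
  have h := (((hamiltonian_commute_parity f).symm.smul_right
    (-(Complex.I * (t : ℂ)))).exp_right).eq
  rw [evolvedState, Matrix.mulVec_mulVec, h, ← Matrix.mulVec_mulVec, parity_mulVec_catState]

theorem average_eq_zero_of_anticommute_parity (f : Fin N → ℝ) (t : ℝ) {O : Op N}
    (hO : O * parity N = -(parity N * O)) : average f t O = 0 := by
  have hP := parity_mulVec_evolvedState f t
  have hstar : (parity N)ᴴ = parity N := star_zString _
  have h : average f t O = -average f t O := by
    calc average f t O = star (evolvedState f t) ⬝ᵥ (O *ᵥ (parity N *ᵥ evolvedState f t)) := by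
          rw [hP, average]
      _ = -(star (evolvedState f t) ⬝ᵥ (parity N *ᵥ (O *ᵥ evolvedState f t))) := by
          rw [Matrix.mulVec_mulVec, hO, Matrix.neg_mulVec, dotProduct_neg, Matrix.mulVec_mulVec]
      _ = -(star (parity N *ᵥ evolvedState f t) ⬝ᵥ (O *ᵥ evolvedState f t)) := by
          rw [Matrix.star_mulVec, hstar, Matrix.dotProduct_mulVec]
      _ = -average f t O := by rw [hP, average]
  exact self_eq_neg.1 h

theorem norm_average_sub_le_of_evenClose (h : ℝ) {P : ℕ} {C T M : ℝ} (hM : 0 ≤ M)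
    {u v : Fin (P + 1) → ℝ}
    (huv : ∀ p, |u p| ≤ C / (N : ℝ) ^ 3 ∧ |v p| ≤ C / (N : ℝ) ^ 3) {t : ℝ}
    (ht : |t| ≤ T * (N : ℝ) ^ 2) {O : Op N}
    (hO : ∀ ε : ℝ, 0 ≤ ε → (∀ j, |(h + longWaveField N P u v j) - h| ≤ ε) →
      EvenClose (fun j => h + longWaveField N P u v j) (fun _ => h) t O (M * (4 * ε * |t|))) :
    ‖average (fun j => h + longWaveField N P u v j) t O - average (fun _ => h) t O‖ ≤
      (16 * M * (P + 1) * C * T) / (N : ℝ) := by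
  have hN : (0 : ℝ) < N := Nat.cast_pos.2 (NeZero.pos N)
  have hc : 0 ≤ C / (N : ℝ) ^ 3 := (abs_nonneg _).trans (huv 0).1
  -- The supremum of the disorder: `P + 1` modes, each with a cosine and a sine of amplitude at most
  -- `C / N³`.
  refine (hO ((P + 1) * (2 * (C / (N : ℝ) ^ 3))) (by positivity) fun j => by
    rw [add_sub_cancel_left]; exact abs_longWaveField_le huv j).norm_average_sub_le.trans ?_
  calc _ ≤ 2 * (M * (4 * ((P + 1) * (2 * (C / (N : ℝ) ^ 3))) * (T * (N : ℝ) ^ 2))) := by gcongr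
    _ = _ := by field_simp; ring

end Correlators

end IsingQuench

theorem mainTheorem3 (h : ℝ) (hh : 1 < h) (L d P : ℕ) (C T : ℝ) :
    -- an even number of `σˣ` at mutual distance at most `d`
    (Even L → ∃ K : ℝ, ∀ (N : ℕ) [NeZero N] (u v : Fin (P + 1) → ℝ),
      (∀ p, |u p| ≤ C / (N : ℝ) ^ 3 ∧ |v p| ≤ C / (N : ℝ) ^ 3) →
      ∀ i : Fin L → Fin N, (∀ a b, IsingQuench.siteDist (i a) (i b) ≤ d) →
      ∀ t : ℝ, |t| ≤ T * (N : ℝ) ^ 2 →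
        ‖IsingQuench.corrX (fun j => h + IsingQuench.longWaveField N P u v j) t i -
          IsingQuench.corrX (fun _ => h) t i‖ ≤ K / (N : ℝ)) ∧
    -- an odd number of `σˣ`
    (Odd L → ∀ (N : ℕ) [NeZero N] (f : Fin N → ℝ) (i : Fin L → Fin N) (t : ℝ),
      IsingQuench.corrX f t i = 0) ∧
    -- any number of `σᶻ`, at arbitrary sites
    (∃ K : ℝ, ∀ (N : ℕ) [NeZero N] (u v : Fin (P + 1) → ℝ),
      (∀ p, |u p| ≤ C / (N : ℝ) ^ 3 ∧ |v p| ≤ C / (N : ℝ) ^ 3) →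
      ∀ (i : Fin L → Fin N) (t : ℝ), |t| ≤ T * (N : ℝ) ^ 2 →
        ‖IsingQuench.corrZ (fun j => h + IsingQuench.longWaveField N P u v j) t i -
          IsingQuench.corrZ (fun _ => h) t i‖ ≤ K / (N : ℝ)) := by
  refine ⟨fun hL => ?_, fun hL N _ f i t => ?_, ?_⟩
  · obtain ⟨m, rfl⟩ := even_iff_exists_two_mul.1 hL
    -- `m * d` bounds the number of bonds; `16 = 2 · 4 · 2` comes from the bound on the state, the
    -- pair of Majoranas in a bond, and the cosine and sine of each mode.
    refine ⟨16 * (m * d) * (P + 1) * C * T, fun N _ u v huv i hi t ht => ?_⟩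
    refine IsingQuench.norm_average_sub_le_of_evenClose h (by positivity) huv ht
      fun ε hε hδ => ?_
    exact (IsingQuench.evenClose_prod_sigmaX hε hδ t m i hi).mono (le_of_eq (by ring))
  · refine IsingQuench.average_eq_zero_of_anticommute_parity f t ?_
    rw [IsingQuench.prod_sigmaX_mul_parity, hL.neg_one_pow, neg_one_smul]
  · refine ⟨16 * L * (P + 1) * C * T, fun N _ u v huv i t ht => ?_⟩
    exact IsingQuench.norm_average_sub_le_of_evenClose h (by positivity) huv ht
      fun ε hε hδ => IsingQuench.evenClose_prod_sigmaZ hε hδ t L i
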